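/- **Setting.** A Muller transition system $\mathcal T=(V,E,\mathrm{Source},\mathrm{Target},I_0,\mathcal F)$ consists of a finite directed graph with vertex set $V$, edge set $E$ and maps $\mathrm{Source},\mathrm{Target}:E\to V$ (parallel edges and self-loops allowed), a non-empty set $I_0\subseteq V$ of initial vertices, and a family $\mathcal F\subseteq\mathcal P(E)$. Every vertex has at least one outgoing edge, and every vertex is accessible, i.e. can be reached by a finite (possibly empty) path from $I_0$. A run is an infinite path $e_0e_1\cdots\in E^\omega$ starting in $I_0$. For an infinite word $u$, $\mathrm{Inf}(u)$ is the set of letters occurring infinitely often in $u$. The Muller condition accepts a run $\varrho$ if $\mathrm{Inf}(\varrho)\in\mathcal F$. A *parity condition* over $\mathcal T$ is a map $p:E\to\mathbb N$; it accepts $\varrho=e_0e_1\cdots$ if $\min\mathrm{Inf}(p(e_0)p(e_1)\cdots)$ is even. It is *equivalent to $\mathcal F$ over $\mathcal T$* if it accepts the same runs of $\mathcal T$ as $\mathcal F$. It is a $[\mu,\eta]$-parity condition if $p(E)\subseteq\{\mu,\dots,\eta\}$. It is a $\mathit{Weak}_k$ condition if there is an ordered partition $V_1,\dots,V_s$ of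 $V$ (every edge from $V_i$ to $V_j$ satisfies $i\ge j$) such that for each $i$ the edges with both endpoints in $V_i$ carry at most $k$ different priorities. A *loop* is the set $l\subseteq E$ of edges appearing in some non-empty finite path from a vertex to itself; $\mathrm{States}(l)$ is the set of sources of edges of $l$; $l$ is accepting if $l\in\mathcal F$ and rejecting otherwise. The *alternating cycle decomposition* $\mathcal{ACD}(\mathcal T)$ is the following family of finite labelled trees. There is one *proper* tree $t_l$ for each maximal loop $l$ of $\mathcal T$; its root is labelled $l$, and a node labelled $m$ has exactly one child labelled $s$ for each maximal element $s$ of the set of loops contained in $m$ whose accepting status is opposite to that of $m$. The tree $t_l$ is *even* if $l\in\mathcal F$ and *odd* otherwise. In addition there is a tree $t_0$ with a single node, labelled with the set of edges lying in no loop; the states of that node are the vertices lying on no loop, while the states of any other node are the states of its label. Each $q\in V$ is a state of the root of exactly one tree $t$ of the family, and $t_q$ denotes the subtree of $t$ consisting of the nodes that have $q$ among their states. The height of a tree is the maximal depth of a leaf plus one, the root having depth $0$. $\mathcal{ACD}(\mathcal T)$ is a *parity ACD* if for every $q\in V$ each node of $t_q$ has at most one child in $t_q$. It is a *$[1,\eta]$-parity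 ACD* (resp. *$[0,\eta-1]$-parity ACD*) if it is a parity ACD, every tree has height at most $\eta$, and every proper tree of height $\eta$ is odd (resp. even). It is a *$\mathit{Weak}_k$ ACD* if it is a parity ACD and every tree has height at most $k$. **Proposition.** For every such $\mathcal T$ the following conditions are equivalent: 1. There is a parity condition over $\mathcal T$ that is equivalent to $\mathcal F$ over $\mathcal T$. 2. For all loops $l_1,l_2$ of $\mathcal T$ such that $l_1\cup l_2$ is a loop: if $l_1\in\mathcal F\Leftrightarrow l_2\in\mathcal F$, then $l_1\cup l_2\in\mathcal F\Leftrightarrow l_1\in\mathcal F$. 3. $\mathcal{ACD}(\mathcal T)$ is a parity ACD. Moreover, for all integers $\eta\ge1$ and $k\ge1$: there is a $[1,\eta]$-parity (resp. $[0,\eta-1]$-parity, $\mathit{Weak}_k$) condition equivalent to $\mathcal F$ over $\mathcal T$ if and only if $\mathcal{ACD}(\mathcal T)$ is a $[1,\eta]$-parity ACD (resp. $[0,\eta-1]$-parity ACD, $\mathit{Weak}_k$ ACD). -/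

import Mathlib

/-- A transition system graph: a directed graph with vertices `V` and edges `E`, a non-empty set
of initial vertices, and at least one outgoing edge at every vertex. -/
structure TransitionGraph (V E : Type*) where
  source : E → V
  target : E → V
  init : Set V
  init_nonempty : init.Nonempty
  exists_out : ∀ v : V, ∃ e : E, source e = v

/-- A Muller transition system whose colours are its edges. -/
structure MullerSystem (V E : Type*) extends TransitionGraph V E where
  /-- The family of accepting sets of edges. -/
  F : Set (Set E)

/-- `infOften u` is the set `Inf(u)` of letters that occur infinitely often in `u`. -/
def infOften {A : Type*} (u : ℕ → A) : Set A := {a | {i | u i = a}.Infinite}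

/-- The Muller condition represented by a family `F` of sets of edges. -/
def mullerAcc {E : Type*} (F : Set (Set E)) : Set (ℕ → E) := {ϱ | infOften ϱ ∈ F}

/-- The parity condition represented by an assignment `p` of priorities to edges: the minimal
priority produced infinitely often is even. -/
def parityAcc {E : Type*} (p : E → ℕ) : Set (ℕ → E) :=
  {ϱ | ∃ m, IsLeast (infOften (fun i => p (ϱ i))) m ∧ Even m}

namespace TransitionGraph

variable {V E : Type*} (G : TransitionGraph V E)

/-- `G.FinRun v ϱ w`: the finite word `ϱ` is a run on `G` that leads from `v` to `w`. -/
def FinRun : V → List E → V → Prop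
  | v, [], w => v = w
  | v, e :: ϱ, w => G.source e = v ∧ FinRun (G.target e) ϱ w

/-- The infinite runs of `G` starting at an initial vertex. -/
def IsInfRun (ϱ : ℕ → E) : Prop :=
  G.source (ϱ 0) ∈ G.init ∧ ∀ i, G.target (ϱ i) = G.source (ϱ (i + 1))

/-- A vertex is accessible if some finite run leads to it from an initial vertex. -/
def Accessible (v : V) : Prop := ∃ v₀ ∈ G.init, ∃ ϱ, G.FinRun v₀ ϱ v

/-- Two acceptance conditions are equivalent over `G` if they accept the same runs of `G`. -/
def EquivOver (A B : Set (ℕ → E)) : Prop := ∀ ϱ, G.IsInfRun ϱ → (ϱ ∈ A ↔ ϱ ∈ B)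

/-- A loop: the set of edges that appear in some non-empty finite run from a vertex to itself. -/
def IsLoop (l : Set E) : Prop :=
  ∃ (v : V) (ϱ : List E), ϱ ≠ [] ∧ G.FinRun v ϱ v ∧ {e | e ∈ ϱ} = l

/-- The set of states of a loop. -/
def statesOf (l : Set E) : Set V := {v | ∃ e ∈ l, G.source e = v}

/-- The maximal loops of `G`. -/
def MaxLoop : Type _ := {l : Set E // Maximal G.IsLoop l}

/-- `c` is an ordered partition `V_0, …, V_{s-1}` of `G` (with `V_i = c ⁻¹' {i}`): every transition
from a vertex of `V_i` to a vertex of `V_j` satisfies `j ≤ i`. -/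
def IsOrderedPartition {s : ℕ} (c : V → Fin s) : Prop :=
  ∀ e : E, c (G.target e) ≤ c (G.source e)

/-- The parity condition `p` is a `Weak_k` condition: for some ordered partition, the transitions
between vertices of any one component carry at most `k` different priorities. -/
def IsWeak (k : ℕ) (p : E → ℕ) : Prop :=
  ∃ (s : ℕ) (c : V → Fin s), G.IsOrderedPartition c ∧
    ∀ i, (p '' {e | c (G.source e) = i ∧ c (G.target e) = i}).encard ≤ k

end TransitionGraph

/-- A tree: a prefix-closed set of finite sequences. -/
structure SeqTree (A : Type*) where
  nodes : Set (List A)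
  mem_of_child_mem : ∀ (τ : List A) (a : A), τ ++ [a] ∈ nodes → τ ∈ nodes

namespace SeqTree

variable {A : Type*} (t : SeqTree A)

/-- The children of a node. -/
def children (τ : List A) : Set (List A) := {σ ∈ t.nodes | ∃ a, σ = τ ++ [a]}

/-- A leaf is a node that is maximal for the prefix relation. -/
def IsLeaf (τ : List A) : Prop := τ ∈ t.nodes ∧ ∀ σ ∈ t.nodes, τ <+: σ → σ = τ

/-- The height of a tree: the maximal depth of a leaf plus one. -/
noncomputable def height : ℕ∞ := ⨆ (τ : List A) (_ : t.IsLeaf τ), ((τ.length : ℕ∞) + 1)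

/-- Parity shape: every node has at most one child. -/
def ParityShape : Prop := ∀ τ ∈ t.nodes, (t.children τ).Subsingleton

end SeqTree

namespace MullerSystem

variable {V E : Type*} (T : MullerSystem V E)

/-- `T.AltChild l s`: `s` is one of the maximal loops among the loops contained in `l` whose
accepting status is opposite to that of `l`. -/
def AltChild (l s : Set E) : Prop :=
  Maximal (fun l' : Set E => l' ⊆ l ∧ T.IsLoop l' ∧ (l' ∈ T.F ↔ l ∉ T.F)) s

/-- The trees of the alternating cycle decomposition. They are indexed by the maximal loops of `T`
(the proper trees), with one more index `none` for the special tree that consists of a root only.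

The children of a node have pairwise different labels, and a node is addressed by the labels met on
the way to it from the root: the root is `[]`, and the children of `τ` are the sequences
`τ ++ [s]`, where `s` ranges over the loops `s` with `T.AltChild (label of τ) s`. -/
def acdTree : Option T.MaxLoop → SeqTree (Set E)
  | none => { nodes := {[]}
              mem_of_child_mem := by intro τ a h; simp at h }
  | some l => { nodes := {τ | List.IsChain T.AltChild (l.1 :: τ)}
                mem_of_child_mem := by
                  intro τ a h
                  have h' : List.IsChain T.AltChild ((l.1 :: τ) ++ [a]) := h
                  exact h'.left_of_append }

/-- The labels `ν_i(τ)` of the nodes. The special tree is labelled with the edges that lie in no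
maximal loop. -/
def acdLabel : Option T.MaxLoop → List (Set E) → Set E
  | none, _ => {e | ∀ l : T.MaxLoop, e ∉ l.1}
  | some l, τ => τ.getLastD l.1

/-- The states `States_i(τ)` of the nodes. The states of the root of the special tree are those
that lie on no maximal loop. -/
def acdStates : Option T.MaxLoop → List (Set E) → Set V
  | none, _ => {v | ∀ l : T.MaxLoop, v ∉ T.statesOf l.1}
  | some l, τ => T.statesOf (T.acdLabel (some l) τ)

theorem acdStates_subset (i : Option T.MaxLoop) (τ : List (Set E)) (a : Set E)
    (h : τ ++ [a] ∈ (T.acdTree i).nodes) : T.acdStates i (τ ++ [a]) ⊆ T.acdStates i τ := by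
  cases i with
  | none => exact fun _ hx => hx
  | some l =>
    have h' : List.IsChain T.AltChild (l.1 :: (τ ++ [a])) := h
    have key : ∀ (τ : List (Set E)) (b : Set E),
        List.IsChain T.AltChild (b :: (τ ++ [a])) → a ⊆ τ.getLastD b := by
      intro τ
      induction τ with
      | nil =>
        intro b hb
        simp only [List.nil_append, List.isChain_cons_cons] at hb
        simpa using hb.1.prop.1
      | cons c τ ih =>
        intro b hb
        simp only [List.cons_append, List.isChain_cons_cons] at hb
        have := ih c (by simpa using hb.2)
        simpa only [List.getLastD_cons] using this
    rintro v ⟨e, he, hv⟩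
    have he' : e ∈ a := by simpa [acdLabel] using he
    exact ⟨e, key τ l.1 h' he', hv⟩

/-- The subtree `t_q` of the tree `t_i` associated to a state `q` of index `i`: the nodes that have
`q` among their states. -/
def stateTree (i : Option T.MaxLoop) (q : V) : SeqTree (Set E) where
  nodes := {τ ∈ (T.acdTree i).nodes | q ∈ T.acdStates i τ}
  mem_of_child_mem := fun τ a h =>
    ⟨(T.acdTree i).mem_of_child_mem τ a h.1, T.acdStates_subset i τ a h.1 h.2⟩

/-- `i` is the index of the state `q`. -/
def HasIndex (q : V) (i : Option T.MaxLoop) : Prop := q ∈ T.acdStates i []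

/-- A proper tree is even if the label of its root is accepting. -/
def EvenTree (l : T.MaxLoop) : Prop := T.acdLabel (some l) [] ∈ T.F

/-- A proper tree is odd if the label of its root is rejecting. -/
def OddTree (l : T.MaxLoop) : Prop := T.acdLabel (some l) [] ∉ T.F

/-- The alternating cycle decomposition is a parity ACD: for every state `q`, the tree `t_q` has
parity shape. -/
def IsParityACD : Prop := ∀ q i, T.HasIndex q i → (T.stateTree i q).ParityShape

/-- `[1,η]`-parity ACD. -/
def IsOneParityACD (η : ℕ) : Prop :=
  T.IsParityACD ∧ (∀ i, (T.acdTree i).height ≤ η) ∧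
    ∀ l : T.MaxLoop, (T.acdTree (some l)).height = η → T.OddTree l

/-- `[0,η-1]`-parity ACD. -/
def IsZeroParityACD (η : ℕ) : Prop :=
  T.IsParityACD ∧ (∀ i, (T.acdTree i).height ≤ η) ∧
    ∀ l : T.MaxLoop, (T.acdTree (some l)).height = η → T.EvenTree l

/-- `Weak_k` ACD. -/
def IsWeakACD (k : ℕ) : Prop :=
  T.IsParityACD ∧ ∀ i, (T.acdTree i).height ≤ k

/-- The parity condition given by `p` is equivalent to the Muller condition of `T` over `T`. -/
def IsEquivParity (p : E → ℕ) : Prop := T.EquivOver (parityAcc p) (mullerAcc T.F)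

end MullerSystem

/-! Since `E` is finite and every vertex is accessible, the sets `infOften ϱ` of runs are exactly
the loops. Equivalence thus becomes a finite condition (`isEquivParity_iff`): on each loop the least
priority is even exactly when the loop is accepting. The least priority on a union is one of the two
least priorities, which gives union compatibility. Two siblings sharing a state have a loop as
union; compatibility gives it their status, so maximality makes them equal and the ACD has parity
shape. Conversely, give an edge the depth of the deepest node containing it, shifted by a constant
encoding the status of its root. A loop `l` has the status of a deepest node `τ` containing it,
since otherwise `l` would fit into a child. Parity shape forces some edge of `l` to have depth
exactly that of `τ` (`IsParityACD.exists_edgeDepth_eq`): if all went deeper, the nodes one level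
down containing consecutive edges would coincide, sharing a state, and one of them would contain
`l`. For the quantitative part, status alternates along a branch, so the least priority strictly
increases, which bounds heights by the available priorities. The depth priorities, suitably shifted,
attain these bounds. -/

/-! ### Letters occurring infinitely often. -/

theorem mem_infOften {A : Type*} {u : ℕ → A} {a : A} : a ∈ infOften u ↔ {i | u i = a}.Infinite :=
  Iff.rfl

theorem infOften_comp {A B : Type*} [Finite A] (u : ℕ → A) (p : A → B) :
    infOften (fun i => p (u i)) = p '' infOften u := by
  ext m
  constructor
  · intro hm
    by_contra hne
    refine hm ?_
    have : {i | p (u i) = m} ⊆ ⋃ a ∈ {a | p a = m}, {i | u i = a} := by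
      intro i hi
      simpa using hi
    refine Set.Finite.subset (Set.Finite.biUnion (Set.toFinite _) fun a ha => ?_) this
    by_contra hinf
    exact hne ⟨a, hinf, ha⟩
  · rintro ⟨a, ha, rfl⟩
    refine Set.Infinite.mono ?_ ha
    intro i hi
    have hi' : u i = a := hi
    simp [hi']

theorem exists_forall_ge_mem_infOften {A : Type*} [Finite A] (u : ℕ → A) :
    ∃ N, ∀ i, N ≤ i → u i ∈ infOften u := by
  have hfin : {i | u i ∉ infOften u}.Finite := by
    have : {i | u i ∉ infOften u} ⊆ ⋃ a ∈ (infOften u)ᶜ, {i | u i = a} := by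
      intro i hi
      simpa using hi
    refine Set.Finite.subset (Set.Finite.biUnion (Set.toFinite _) fun a ha => ?_) this
    by_contra hinf
    exact ha hinf
  obtain ⟨N, hN⟩ := hfin.bddAbove
  refine ⟨N + 1, fun i hi => ?_⟩
  by_contra h
  have := hN h
  omega

theorem infOften_cons {A : Type*} (u v : ℕ → A) (h : ∀ i, v (i + 1) = u i) :
    infOften v = infOften u := by
  ext a
  constructor
  · intro ha
    rw [mem_infOften, Set.infinite_iff_exists_gt]
    intro n
    obtain ⟨i, hi, hni⟩ := Set.Infinite.exists_gt ha (n + 1)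
    obtain ⟨j, rfl⟩ : ∃ j, i = j + 1 := ⟨i - 1, by omega⟩
    exact ⟨j, (h j).symm.trans hi, by omega⟩
  · intro ha
    rw [mem_infOften, Set.infinite_iff_exists_gt]
    intro n
    obtain ⟨i, hi, hni⟩ := Set.Infinite.exists_gt ha n
    exact ⟨i + 1, (h i).trans hi, by omega⟩

/-! ### Runs, loops and reachability. -/

namespace TransitionGraph

variable {V E : Type*} {G : TransitionGraph V E}

theorem finRun_append {u w : V} {a b : List E} :
    G.FinRun u (a ++ b) w ↔ ∃ v, G.FinRun u a v ∧ G.FinRun v b w := by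
  induction a generalizing u with
  | nil => simp [FinRun]
  | cons e a ih => simp [FinRun, ih, and_assoc]

theorem finRun_range' {u : ℕ → E} (hu : ∀ i, G.target (u i) = G.source (u (i + 1))) (N k : ℕ) :
    G.FinRun (G.source (u N)) ((List.range' N k).map u) (G.source (u (N + k))) := by
  induction k generalizing N with
  | zero => simp [FinRun]
  | succ k ih =>
    simp only [List.range'_succ, List.map_cons, FinRun, true_and, hu]
    have := ih (N + 1)
    rwa [show N + 1 + k = N + (k + 1) by omega] at this

/-- From some time `N` on only recurrent edges occur. A segment starting at `N`, long enough to see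
them all and stopped just before a recurrence of `u N`, is a closed path. -/
theorem isLoop_infOften [Finite E] {u : ℕ → E}
    (hu : ∀ i, G.target (u i) = G.source (u (i + 1))) : G.IsLoop (infOften u) := by
  obtain ⟨N, hN⟩ := exists_forall_ge_mem_infOften u
  have hex : ∀ e : E, ∃ i, e ∈ infOften u → N ≤ i ∧ u i = e := by
    intro e
    by_cases he : e ∈ infOften u
    · obtain ⟨i, hi, hNi⟩ := Set.Infinite.exists_gt he N
      exact ⟨i, fun _ => ⟨hNi.le, hi⟩⟩
    · exact ⟨0, fun h => absurd h he⟩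
  choose f hf using hex
  obtain ⟨B, hB⟩ := (Set.finite_range f).bddAbove
  obtain ⟨M, hM, hBM⟩ := Set.Infinite.exists_gt (hN N le_rfl) (max B N)
  have hM' : u M = u N := hM
  obtain ⟨k, rfl⟩ : ∃ k, M = N + k := ⟨M - N, by omega⟩
  refine ⟨G.source (u N), (List.range' N k).map u, ?_, ?_, ?_⟩
  · simp only [ne_eq, List.map_eq_nil_iff, List.range'_eq_nil_iff]
    omega
  · have := finRun_range' hu N k
    rwa [hM'] at this
  · ext e
    simp only [List.mem_map, List.mem_range'_1, Set.mem_ofPred_eq]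
    constructor
    · rintro ⟨i, hi, rfl⟩
      exact hN i hi.1
    · intro he
      obtain ⟨h1, h2⟩ := hf e he
      have : f e ≤ B := hB ⟨e, rfl⟩
      exact ⟨f e, ⟨h1, by omega⟩, h2⟩

theorem FinRun.source_getElem_zero {v w : V} {ϱ : List E} (h : G.FinRun v ϱ w)
    (h0 : 0 < ϱ.length) : G.source ϱ[0] = v := by
  cases ϱ with
  | nil => simp at h0
  | cons e ϱ => exact h.1

theorem FinRun.target_getElem {v w : V} {ϱ : List E} (h : G.FinRun v ϱ w) (i : ℕ)
    (hi : i + 1 < ϱ.length) : G.target ϱ[i] = G.source ϱ[i + 1] := by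
  induction ϱ generalizing v i with
  | nil => simp at hi
  | cons e ϱ ih =>
    simp only [List.length_cons, add_lt_add_iff_right] at hi
    cases i with
    | zero => exact (h.2.source_getElem_zero hi).symm
    | succ i => exact ih h.2 i hi

theorem FinRun.target_getElem_last {v w : V} {ϱ : List E} (h : G.FinRun v ϱ w) (i : ℕ)
    (hi : i + 1 = ϱ.length) : G.target (ϱ[i]'(by omega)) = w := by
  induction ϱ generalizing v i with
  | nil => simp at hi
  | cons e ϱ ih =>
    cases i with
    | zero =>
      have hϱ : ϱ = [] := by simpa using hi
      subst hϱ
      exact h.2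
    | succ i => exact ih h.2 i (by simpa using hi)

theorem exists_run_of_finRun {u : ℕ → E} (hu : ∀ i, G.target (u i) = G.source (u (i + 1)))
    {v : V} {π : List E} (hπ : G.FinRun v π (G.source (u 0))) :
    ∃ u' : ℕ → E, G.source (u' 0) = v ∧ (∀ i, G.target (u' i) = G.source (u' (i + 1))) ∧
      infOften u' = infOften u := by
  induction π generalizing v with
  | nil => exact ⟨u, hπ.symm, hu, rfl⟩
  | cons e π ih =>
    obtain ⟨u', h0, h1, h2⟩ := ih hπ.2
    refine ⟨fun n => n.casesOn e u', hπ.1, ?_, ?_⟩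
    · rintro (_ | i)
      · exact h0.symm
      · exact h1 i
    · rw [← h2]
      exact infOften_cons _ _ fun i => rfl

/-- Repeat the closed path forever and prefix it with an access path; a finite prefix does not
change what recurs. -/
theorem IsLoop.exists_isInfRun {l : Set E} (hl : G.IsLoop l) (hacc : ∀ v, G.Accessible v) :
    ∃ ϱ, G.IsInfRun ϱ ∧ infOften ϱ = l := by
  obtain ⟨v, ϱ, hne, hrun, rfl⟩ := hl
  obtain ⟨v₀, hv₀, π, hπ⟩ := hacc v
  have hlen : 0 < ϱ.length := List.length_pos_iff.2 hne
  let u : ℕ → E := fun i => ϱ[i % ϱ.length]'(Nat.mod_lt _ hlen)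
  have hu0 : G.source (u 0) = v := by
    have := hrun.source_getElem_zero hlen
    simpa [u] using this
  have hu : ∀ i, G.target (u i) = G.source (u (i + 1)) := by
    intro i
    have hi := Nat.mod_lt i hlen
    by_cases h : i % ϱ.length + 1 < ϱ.length
    · have e : (i + 1) % ϱ.length = i % ϱ.length + 1 := by
        rw [Nat.add_mod, Nat.mod_eq_of_lt (by omega : 1 < ϱ.length), Nat.mod_eq_of_lt h]
      simpa only [u, e] using hrun.target_getElem _ h
    · have hl : i % ϱ.length + 1 = ϱ.length := by omega
      have e : (i + 1) % ϱ.length = 0 := by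
        rw [← Nat.mod_add_mod, hl, Nat.mod_self]
      have h1 := hrun.target_getElem_last _ hl
      have h2 := hrun.source_getElem_zero hlen
      simp only [u, e]
      rw [h1, h2]
  obtain ⟨u', h0, h1, h2⟩ := exists_run_of_finRun hu (hu0 ▸ hπ)
  refine ⟨u', ⟨h0 ▸ hv₀, h1⟩, h2.trans ?_⟩
  ext e
  constructor
  · intro he
    obtain ⟨i, hi⟩ := Set.Infinite.nonempty he
    have hi' : u i = e := hi
    rw [← hi']
    exact List.getElem_mem _
  · intro he
    obtain ⟨j, hj, rfl⟩ := List.getElem_of_mem he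
    rw [mem_infOften, Set.infinite_iff_exists_gt]
    intro n
    refine ⟨j + ϱ.length * (n + 1), ?_, ?_⟩
    · simp [u, Nat.add_mul_mod_self_left, Nat.mod_eq_of_lt hj]
    · nlinarith

theorem IsLoop.exists_finRun {l : Set E} (hl : G.IsLoop l) {v : V} (hv : v ∈ G.statesOf l) :
    ∃ ϱ, ϱ ≠ [] ∧ G.FinRun v ϱ v ∧ {e | e ∈ ϱ} = l := by
  obtain ⟨w, ϱ, -, hrun, rfl⟩ := hl
  obtain ⟨e, he, rfl⟩ := hv
  obtain ⟨a, b, rfl⟩ := List.append_of_mem he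
  obtain ⟨x, hx, h1, h2⟩ := finRun_append.1 hrun
  refine ⟨(e :: b) ++ a, by simp, finRun_append.2 ⟨w, ⟨rfl, h2⟩, h1 ▸ hx⟩, ?_⟩
  ext
  simp only [List.mem_append, Set.mem_ofPred_eq]
  exact or_comm

/-- A closed path can be rotated to start at any of its states, so both can be concatenated at the
common one. -/
theorem IsLoop.union {l₁ l₂ : Set E} (h₁ : G.IsLoop l₁) (h₂ : G.IsLoop l₂) {v : V}
    (hv₁ : v ∈ G.statesOf l₁) (hv₂ : v ∈ G.statesOf l₂) : G.IsLoop (l₁ ∪ l₂) := by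
  obtain ⟨ϱ, hne, hϱ, rfl⟩ := h₁.exists_finRun hv₁
  obtain ⟨π, -, hπ, rfl⟩ := h₂.exists_finRun hv₂
  refine ⟨v, ϱ ++ π, by simp [hne], finRun_append.2 ⟨v, hϱ, hπ⟩, ?_⟩
  ext
  simp

theorem IsLoop.nonempty {l : Set E} (hl : G.IsLoop l) : l.Nonempty := by
  obtain ⟨v, ϱ, hne, -, rfl⟩ := hl
  exact List.exists_mem_of_ne_nil ϱ hne

theorem source_mem_statesOf {l : Set E} {e : E} (he : e ∈ l) : G.source e ∈ G.statesOf l :=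
  ⟨e, he, rfl⟩

theorem IsLoop.target_mem {l : Set E} (hl : G.IsLoop l) {e : E} (he : e ∈ l) :
    G.target e ∈ G.statesOf l := by
  obtain ⟨ϱ, -, hrun, rfl⟩ := hl.exists_finRun (source_mem_statesOf he)
  obtain ⟨a, b, rfl⟩ := List.append_of_mem he
  obtain ⟨x, hx, h1, h2⟩ := finRun_append.1 hrun
  cases b with
  | nil =>
    have h2' : G.target e = G.source e := h2
    exact h2' ▸ source_mem_statesOf he
  | cons f b => exact ⟨f, by simp, h2.1⟩

theorem FinRun.apply_eq_of_mem {X : Type*} {f : E → X} {l : Set E}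
    (hf : ∀ e ∈ l, ∀ e' ∈ l, G.target e = G.source e' → f e = f e') {v w : V} {e : E}
    {ϱ : List E} (hrun : G.FinRun v (e :: ϱ) w) (hl : ∀ e' ∈ e :: ϱ, e' ∈ l) :
    ∀ e' ∈ ϱ, f e' = f e := by
  induction ϱ generalizing v e with
  | nil => simp
  | cons a ϱ ih =>
    have h1 : f e = f a := hf e (hl e (by simp)) a (hl a (by simp)) hrun.2.1.symm
    have h2 := ih hrun.2 fun e' he' => hl e' (List.mem_cons_of_mem _ he')
    intro e' he'
    rcases List.mem_cons.1 he' with rfl | he'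
    · exact h1.symm
    · exact (h2 e' he').trans h1.symm

/-- A function on edges that takes the same value on consecutive edges is constant on a loop. -/
theorem IsLoop.apply_eq {X : Type*} {f : E → X} {l : Set E} (hl : G.IsLoop l)
    (hf : ∀ e ∈ l, ∀ e' ∈ l, G.target e = G.source e' → f e = f e') {e e' : E} (he : e ∈ l)
    (he' : e' ∈ l) : f e = f e' := by
  obtain ⟨v, ϱ, hne, hrun, rfl⟩ := hl
  cases ϱ with
  | nil => exact absurd rfl hne
  | cons a ϱ =>
    have key := hrun.apply_eq_of_mem hf fun _ h => h
    have : ∀ e ∈ a :: ϱ, f e = f a := by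
      intro e he
      rcases List.mem_cons.1 he with rfl | he
      · rfl
      · exact key e he
    exact (this e he).trans (this e' he').symm

theorem exists_maxLoop_superset [Finite E] {l : Set E} (hl : G.IsLoop l) :
    ∃ L : G.MaxLoop, l ⊆ L.1 := by
  obtain ⟨m, hlm, hm⟩ := (Set.toFinite {l | G.IsLoop l}).exists_le_maximal hl
  exact ⟨⟨m, hm⟩, hlm⟩

theorem MaxLoop.eq_of_mem_statesOf {L M : G.MaxLoop} {v : V} (hL : v ∈ G.statesOf L.1)
    (hM : v ∈ G.statesOf M.1) : L = M := by
  have h := L.2.prop.union M.2.prop hL hM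
  have h1 := L.2.eq_of_subset h Set.subset_union_left
  have h2 := M.2.eq_of_subset h Set.subset_union_right
  exact Subtype.ext (h1.trans h2.symm)

theorem MaxLoop.eq_of_mem {L M : G.MaxLoop} {e : E} (hL : e ∈ L.1) (hM : e ∈ M.1) : L = M :=
  eq_of_mem_statesOf (source_mem_statesOf hL) (source_mem_statesOf hM)

theorem IsOrderedPartition.le_of_finRun {s : ℕ} {c : V → Fin s} (hc : G.IsOrderedPartition c)
    {v w : V} {ϱ : List E} (h : G.FinRun v ϱ w) : ∀ e ∈ ϱ, c (G.source e) ≤ c v := by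
  induction ϱ generalizing v with
  | nil => simp
  | cons a ϱ ih =>
    intro e he
    rcases List.mem_cons.1 he with rfl | he
    · rw [h.1]
    · exact (ih h.2 e he).trans ((hc a).trans (h.1 ▸ le_rfl))

theorem IsOrderedPartition.eq_of_isLoop {s : ℕ} {c : V → Fin s} (hc : G.IsOrderedPartition c)
    {l : Set E} (hl : G.IsLoop l) {v w : V} (hv : v ∈ G.statesOf l) (hw : w ∈ G.statesOf l) :
    c v = c w := by
  have key : ∀ {v w : V}, v ∈ G.statesOf l → w ∈ G.statesOf l → c w ≤ c v := by
    intro v w hv hw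
    obtain ⟨ϱ, -, hϱ, rfl⟩ := hl.exists_finRun hv
    obtain ⟨e, he, rfl⟩ := hw
    exact hc.le_of_finRun hϱ e he
  exact le_antisymm (key hw hv) (key hv hw)

/-- The vertices reachable from a vertex. -/
def reach (G : TransitionGraph V E) (v : V) : Set V := {w | ∃ ϱ, G.FinRun v ϱ w}

theorem reach_target_subset (e : E) : G.reach (G.target e) ⊆ G.reach (G.source e) := by
  rintro w ⟨ϱ, hϱ⟩
  exact ⟨e :: ϱ, rfl, hϱ⟩

/-- Reachable sets can only shrink along an edge; if the size does not drop, the source is reachable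
from the target, and the way back closes a loop. -/
theorem exists_isLoop_of_ncard_reach_le [Finite V] {e : E}
    (h : (G.reach (G.source e)).ncard ≤ (G.reach (G.target e)).ncard) :
    ∃ l, G.IsLoop l ∧ e ∈ l := by
  have heq := Set.eq_of_subset_of_ncard_le (reach_target_subset e) h (Set.toFinite _)
  have hs : G.source e ∈ G.reach (G.target e) := heq ▸ ⟨[], rfl⟩
  obtain ⟨ϱ, hϱ⟩ := hs
  exact ⟨_, ⟨G.source e, e :: ϱ, by simp, ⟨rfl, hϱ⟩, rfl⟩, by simp⟩

end TransitionGraph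

/-! ### Heights and branches of trees. -/

namespace SeqTree

variable {A : Type*} {t : SeqTree A}

theorem height_le {n : ℕ∞} (h : ∀ τ ∈ t.nodes, (τ.length : ℕ∞) + 1 ≤ n) : t.height ≤ n :=
  iSup₂_le fun τ hτ => h τ hτ.1

/-- Height sees only leaves, so a node must first be extended to a leaf; the bound on lengths
provides a longest extension. -/
theorem length_add_one_le_height {B : ℕ} (hB : ∀ τ ∈ t.nodes, τ.length ≤ B) {τ : List A}
    (hτ : τ ∈ t.nodes) : (τ.length : ℕ∞) + 1 ≤ t.height := by
  have hbdd : BddAbove {n | ∃ σ ∈ t.nodes, τ <+: σ ∧ σ.length = n} := by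
    refine ⟨B, ?_⟩
    rintro n ⟨σ, hσ, -, rfl⟩
    exact hB σ hσ
  obtain ⟨σ, hσ, hτσ, hlen⟩ := Nat.sSup_mem (by exact ⟨τ.length, τ, hτ, List.prefix_rfl, rfl⟩) hbdd
  have hleaf : t.IsLeaf σ := by
    refine ⟨hσ, fun ρ hρ hσρ => ?_⟩
    have : ρ.length ≤ σ.length := by
      rw [hlen]
      exact le_csSup hbdd ⟨ρ, hρ, hτσ.trans hσρ, rfl⟩
    exact (hσρ.eq_of_length_le this).symm
  calc (τ.length : ℕ∞) + 1 ≤ (σ.length : ℕ∞) + 1 := by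
        gcongr
        exact hτσ.length_le
    _ ≤ t.height := le_iSup₂ (f := fun (τ : List A) (_ : t.IsLeaf τ) => (τ.length : ℕ∞) + 1) σ hleaf

theorem take_mem {τ : List A} (hτ : τ ∈ t.nodes) (n : ℕ) : τ.take n ∈ t.nodes := by
  induction τ using List.reverseRecOn with
  | nil => simpa using hτ
  | append_singleton τ a ih =>
    rcases le_or_gt n τ.length with h | h
    · rw [List.take_append_of_le_length h]
      exact ih (t.mem_of_child_mem τ a hτ)
    · rwa [List.take_of_length_le (by simpa using h)]

theorem ParityShape.eq_of_length_eq (ht : t.ParityShape) {τ σ : List A} (hτ : τ ∈ t.nodes)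
    (hσ : σ ∈ t.nodes) (h : τ.length = σ.length) : τ = σ := by
  induction τ using List.reverseRecOn generalizing σ with
  | nil => exact (List.length_eq_zero_iff.1 h.symm).symm
  | append_singleton τ a ih =>
    rcases List.eq_nil_or_concat σ with rfl | ⟨σ, b, rfl⟩
    · simp at h
    · rw [List.concat_eq_append] at *
      have h1 := t.mem_of_child_mem τ a hτ
      have h2 : τ = σ := ih h1 (t.mem_of_child_mem σ b hσ) (by simpa using h)
      subst h2
      exact ht τ h1 ⟨hτ, a, rfl⟩ ⟨hσ, b, rfl⟩

end SeqTree

theorem isLeast_image_union {E : Type*} {p : E → ℕ} {s t : Set E} {m n : ℕ}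
    (hm : IsLeast (p '' s) m) (hn : IsLeast (p '' t) n) : IsLeast (p '' (s ∪ t)) (min m n) := by
  rw [Set.image_union]
  exact hm.union hn

theorem exists_isLeast_image {E : Type*} (p : E → ℕ) {s : Set E} (hs : s.Nonempty) :
    ∃ m, IsLeast (p '' s) m :=
  ⟨_, isLeast_csInf (hs.image p)⟩

/-! ### Parity conditions on loops, and nodes of the ACD. -/

namespace MullerSystem

variable {V E : Type*} {T : MullerSystem V E}

open TransitionGraph

/-- A parity condition is equivalent to the Muller condition if and only if on each loop the minimal
priority is even exactly when the loop is accepting. -/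
theorem isEquivParity_iff [Finite E] (hacc : ∀ v, T.Accessible v) {p : E → ℕ} :
    T.IsEquivParity p ↔
      ∀ l, T.IsLoop l → ∀ m, IsLeast (p '' l) m → (Even m ↔ l ∈ T.F) := by
  constructor
  · intro h l hl m hm
    obtain ⟨ϱ, hϱ, rfl⟩ := hl.exists_isInfRun hacc
    have := h ϱ hϱ
    simp only [parityAcc, mullerAcc, Set.mem_ofPred_eq, infOften_comp] at this
    rw [← this]
    constructor
    · exact fun he => ⟨m, hm, he⟩
    · rintro ⟨n, hn, he⟩
      exact hm.unique hn ▸ he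
  · intro h ϱ hϱ
    simp only [parityAcc, mullerAcc, Set.mem_ofPred_eq, infOften_comp]
    have hl := isLoop_infOften (G := T.toTransitionGraph) hϱ.2
    constructor
    · rintro ⟨n, hn, he⟩
      exact (h _ hl n hn).1 he
    · intro hF
      obtain ⟨m, hm⟩ := exists_isLeast_image p hl.nonempty
      exact ⟨m, hm, (h _ hl m hm).2 hF⟩

theorem nil_mem_acdTree (L : T.MaxLoop) : [] ∈ (T.acdTree (some L)).nodes :=
  List.isChain_singleton _

@[simp] theorem acdLabel_nil (L : T.MaxLoop) : T.acdLabel (some L) [] = L.1 := rfl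

@[simp] theorem acdLabel_append_singleton (L : T.MaxLoop) (τ : List (Set E)) (s : Set E) :
    T.acdLabel (some L) (τ ++ [s]) = s := by
  simp [acdLabel]

theorem append_singleton_mem_acdTree {L : T.MaxLoop} {τ : List (Set E)} {s : Set E} :
    τ ++ [s] ∈ (T.acdTree (some L)).nodes ↔
      τ ∈ (T.acdTree (some L)).nodes ∧ T.AltChild (T.acdLabel (some L) τ) s := by
  have key : ∀ (τ : List (Set E)) (b : Set E), List.IsChain T.AltChild (b :: (τ ++ [s])) ↔
      List.IsChain T.AltChild (b :: τ) ∧ T.AltChild (τ.getLastD b) s := by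
    intro τ
    induction τ with
    | nil => intro b; simp
    | cons c τ ih =>
      intro b
      simp only [List.cons_append, List.isChain_cons_cons, ih c, List.getLastD_cons, and_assoc]
  exact key τ L.1

theorem AltChild.ssubset {l s : Set E} (h : T.AltChild l s) : s ⊂ l := by
  refine h.prop.1.ssubset_of_ne ?_
  rintro rfl
  have := h.prop.2.2
  tauto

theorem acdLabel_isLoop {L : T.MaxLoop} {τ : List (Set E)}
    (hτ : τ ∈ (T.acdTree (some L)).nodes) : T.IsLoop (T.acdLabel (some L) τ) := by
  induction τ using List.reverseRecOn with
  | nil => exact L.2.prop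
  | append_singleton τ s ih =>
    rw [acdLabel_append_singleton]
    exact (append_singleton_mem_acdTree.1 hτ).2.prop.2.1

theorem acdLabel_subset {L : T.MaxLoop} {τ : List (Set E)}
    (hτ : τ ∈ (T.acdTree (some L)).nodes) : T.acdLabel (some L) τ ⊆ L.1 := by
  induction τ using List.reverseRecOn with
  | nil => exact subset_rfl
  | append_singleton τ s ih =>
    obtain ⟨h1, h2⟩ := append_singleton_mem_acdTree.1 hτ
    rw [acdLabel_append_singleton]
    exact h2.prop.1.trans (ih h1)

theorem acdLabel_take_superset {L : T.MaxLoop} {τ : List (Set E)}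
    (hτ : τ ∈ (T.acdTree (some L)).nodes) (n : ℕ) :
    T.acdLabel (some L) τ ⊆ T.acdLabel (some L) (τ.take n) := by
  induction τ using List.reverseRecOn with
  | nil => simp
  | append_singleton τ a ih =>
    rcases le_or_gt n τ.length with h | h
    · obtain ⟨h1, h2⟩ := append_singleton_mem_acdTree.1 hτ
      rw [List.take_append_of_le_length h, acdLabel_append_singleton]
      exact h2.prop.1.trans (ih h1)
    · rw [List.take_of_length_le (by simpa using h)]

theorem acdLabel_mem_F_iff {L : T.MaxLoop} {τ : List (Set E)}
    (hτ : τ ∈ (T.acdTree (some L)).nodes) :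
    T.acdLabel (some L) τ ∈ T.F ↔ (Even τ.length ↔ L.1 ∈ T.F) := by
  induction τ using List.reverseRecOn with
  | nil => simp
  | append_singleton τ s ih =>
    obtain ⟨h1, h2⟩ := append_singleton_mem_acdTree.1 hτ
    have h3 := h2.prop.2.2
    have h4 := ih h1
    rw [acdLabel_append_singleton, List.length_append, List.length_singleton, Nat.even_add_one]
    tauto

/-- Each step down loses at least one edge, which bounds the depth of the trees. -/
theorem length_add_ncard_acdLabel_le [Finite E] {L : T.MaxLoop} {τ : List (Set E)}
    (hτ : τ ∈ (T.acdTree (some L)).nodes) :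
    τ.length + (T.acdLabel (some L) τ).ncard ≤ L.1.ncard := by
  induction τ using List.reverseRecOn with
  | nil => simp
  | append_singleton τ s ih =>
    obtain ⟨h1, h2⟩ := append_singleton_mem_acdTree.1 hτ
    have h3 := ih h1
    have h4 := Set.ncard_lt_ncard h2.ssubset (Set.toFinite _)
    rw [acdLabel_append_singleton, List.length_append, List.length_singleton]
    omega

theorem length_le_of_mem_acdTree [Finite E] {L : T.MaxLoop} {τ : List (Set E)}
    (hτ : τ ∈ (T.acdTree (some L)).nodes) : τ.length ≤ L.1.ncard := by
  have := length_add_ncard_acdLabel_le hτ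
  omega

theorem length_add_one_le_acdTree_height [Finite E] {L : T.MaxLoop} {τ : List (Set E)}
    (hτ : τ ∈ (T.acdTree (some L)).nodes) :
    (τ.length : ℕ∞) + 1 ≤ (T.acdTree (some L)).height :=
  SeqTree.length_add_one_le_height (fun _ h => length_le_of_mem_acdTree h) hτ

theorem acdTree_none_height_le : (T.acdTree none).height ≤ 1 := by
  refine SeqTree.height_le fun τ hτ => ?_
  have : τ = [] := hτ
  subst this
  simp

/-! ### Union compatibility and parity shape. -/

/-- Compatibility of the family of loops with unions. -/
def UnionCompatible (T : MullerSystem V E) : Prop :=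
  ∀ l₁ l₂ : Set E, T.IsLoop l₁ → T.IsLoop l₂ → T.IsLoop (l₁ ∪ l₂) →
    (l₁ ∈ T.F ↔ l₂ ∈ T.F) → (l₁ ∪ l₂ ∈ T.F ↔ l₁ ∈ T.F)

theorem IsEquivParity.unionCompatible [Finite E] (hacc : ∀ v, T.Accessible v) {p : E → ℕ}
    (hp : T.IsEquivParity p) : T.UnionCompatible := by
  rw [isEquivParity_iff hacc] at hp
  intro l₁ l₂ h₁ h₂ h h12
  obtain ⟨m, hm⟩ := exists_isLeast_image p h₁.nonempty
  obtain ⟨n, hn⟩ := exists_isLeast_image p h₂.nonempty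
  rw [← hp _ h _ (isLeast_image_union hm hn), ← hp _ h₁ _ hm]
  rw [← hp _ h₁ _ hm, ← hp _ h₂ _ hn] at h12
  rcases min_choice m n with e | e <;> rw [e]
  exact h12.symm

theorem UnionCompatible.isParityACD (h : T.UnionCompatible) : T.IsParityACD := by
  rintro q (_ | L) - τ hτ σ₁ ⟨⟨h1, hq1⟩, s₁, rfl⟩ σ₂ ⟨⟨h2, hq2⟩, s₂, rfl⟩
  · have : τ ++ [s₁] = [] := h1
    simp at this
  · have a1 := (append_singleton_mem_acdTree.1 h1).2
    have a2 := (append_singleton_mem_acdTree.1 h2).2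
    have q1 : q ∈ T.statesOf s₁ := by simpa [acdStates] using hq1
    have q2 : q ∈ T.statesOf s₂ := by simpa [acdStates] using hq2
    have hu := a1.prop.2.1.union a2.prop.2.1 q1 q2
    have hF := h s₁ s₂ a1.prop.2.1 a2.prop.2.1 hu (a1.prop.2.2.trans a2.prop.2.2.symm)
    have e1 := a1.eq_of_subset (t := s₁ ∪ s₂)
      ⟨Set.union_subset a1.prop.1 a2.prop.1, hu, hF.trans a1.prop.2.2⟩ Set.subset_union_left
    have e2 := a2.eq_of_subset (t := s₁ ∪ s₂)
      ⟨Set.union_subset a1.prop.1 a2.prop.1, hu, hF.trans a1.prop.2.2⟩ Set.subset_union_right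
    rw [e1.trans e2.symm]

/-! ### Depth of edges as a parity condition. -/

/-- The maximal depth of a node of the alternating cycle decomposition whose label contains a given
edge (and `0` for the edges that lie on no loop). -/
noncomputable def edgeDepth (T : MullerSystem V E) (e : E) : ℕ :=
  sSup {n | ∃ L : T.MaxLoop, ∃ τ ∈ (T.acdTree (some L)).nodes,
    e ∈ T.acdLabel (some L) τ ∧ τ.length = n}

theorem bddAbove_depths [Finite E] (e : E) :
    BddAbove {n | ∃ L : T.MaxLoop, ∃ τ ∈ (T.acdTree (some L)).nodes,
      e ∈ T.acdLabel (some L) τ ∧ τ.length = n} := by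
  refine ⟨(Set.univ : Set E).ncard, ?_⟩
  rintro n ⟨L, τ, hτ, -, rfl⟩
  exact (length_le_of_mem_acdTree hτ).trans
    (Set.ncard_le_ncard (Set.subset_univ _) (Set.toFinite _))

theorem length_le_edgeDepth [Finite E] {L : T.MaxLoop} {τ : List (Set E)} {e : E}
    (hτ : τ ∈ (T.acdTree (some L)).nodes) (he : e ∈ T.acdLabel (some L) τ) :
    τ.length ≤ T.edgeDepth e :=
  le_csSup (bddAbove_depths e) ⟨L, τ, hτ, he, rfl⟩

theorem exists_length_eq_edgeDepth [Finite E] {L : T.MaxLoop} {e : E} (he : e ∈ L.1) :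
    ∃ τ ∈ (T.acdTree (some L)).nodes, e ∈ T.acdLabel (some L) τ ∧
      τ.length = T.edgeDepth e := by
  obtain ⟨M, τ, hτ, heτ, hlen⟩ :=
    Nat.sSup_mem (by exact ⟨0, L, [], nil_mem_acdTree L, he, rfl⟩) (bddAbove_depths e)
  obtain rfl : L = M := MaxLoop.eq_of_mem he (acdLabel_subset hτ heτ)
  exact ⟨τ, hτ, heτ, hlen⟩

theorem edgeDepth_add_one_le_height [Finite E] {L : T.MaxLoop} {e : E} (he : e ∈ L.1) :
    (T.edgeDepth e : ℕ∞) + 1 ≤ (T.acdTree (some L)).height := by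
  obtain ⟨τ, hτ, -, hlen⟩ := exists_length_eq_edgeDepth he
  exact hlen ▸ length_add_one_le_acdTree_height hτ

theorem edgeDepth_eq_zero {e : E} (he : ∀ L : T.MaxLoop, e ∉ L.1) : T.edgeDepth e = 0 := by
  have : {n | ∃ L : T.MaxLoop, ∃ τ ∈ (T.acdTree (some L)).nodes,
      e ∈ T.acdLabel (some L) τ ∧ τ.length = n} = ∅ := by
    refine Set.eq_empty_of_forall_notMem ?_
    rintro n ⟨L, τ, hτ, heτ, -⟩
    exact he L (acdLabel_subset hτ heτ)
  rw [edgeDepth, this, csSup_empty]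
  rfl

/-- A deepest node whose label contains a given loop. -/
theorem exists_deepest_node [Finite E] {l : Set E} {L : T.MaxLoop} (hlL : l ⊆ L.1) :
    ∃ τ ∈ (T.acdTree (some L)).nodes, l ⊆ T.acdLabel (some L) τ ∧
      ∀ σ ∈ (T.acdTree (some L)).nodes, l ⊆ T.acdLabel (some L) σ → σ.length ≤ τ.length := by
  have hbdd : BddAbove {n | ∃ τ ∈ (T.acdTree (some L)).nodes,
      l ⊆ T.acdLabel (some L) τ ∧ τ.length = n} := by
    refine ⟨L.1.ncard, ?_⟩
    rintro n ⟨τ, hτ, -, rfl⟩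
    exact length_le_of_mem_acdTree hτ
  obtain ⟨τ, hτ, hlτ, hlen⟩ := Nat.sSup_mem (by exact ⟨0, [], nil_mem_acdTree L, hlL, rfl⟩) hbdd
  refine ⟨τ, hτ, hlτ, fun σ hσ hlσ => ?_⟩
  rw [hlen]
  exact le_csSup hbdd ⟨σ, hσ, hlσ, rfl⟩

/-- If the statuses differed, the loop would lie in a maximal loop of opposite status, that is, in a
child of `τ`. -/
theorem mem_F_iff_of_deepest [Finite E] {l : Set E} (hl : T.IsLoop l) {L : T.MaxLoop}
    {τ : List (Set E)} (hτ : τ ∈ (T.acdTree (some L)).nodes) (hlτ : l ⊆ T.acdLabel (some L) τ)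
    (hmax : ∀ σ ∈ (T.acdTree (some L)).nodes, l ⊆ T.acdLabel (some L) σ →
      σ.length ≤ τ.length) : l ∈ T.F ↔ T.acdLabel (some L) τ ∈ T.F := by
  by_contra hne
  obtain ⟨s, hls, hs⟩ := (Set.toFinite {l' : Set E | l' ⊆ T.acdLabel (some L) τ ∧ T.IsLoop l' ∧
    (l' ∈ T.F ↔ T.acdLabel (some L) τ ∉ T.F)}).exists_le_maximal ⟨hlτ, hl, by tauto⟩
  have := hmax (τ ++ [s]) (append_singleton_mem_acdTree.2 ⟨hτ, hs⟩)
    (by rw [acdLabel_append_singleton]; exact hls)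
  simp at this

theorem IsParityACD.eq_of_length_eq (h : T.IsParityACD) {L : T.MaxLoop} {τ σ : List (Set E)}
    {q : V} (hτ : τ ∈ (T.acdTree (some L)).nodes) (hσ : σ ∈ (T.acdTree (some L)).nodes)
    (hqτ : q ∈ T.statesOf (T.acdLabel (some L) τ)) (hqσ : q ∈ T.statesOf (T.acdLabel (some L) σ))
    (hlen : τ.length = σ.length) : τ = σ := by
  have hq : T.HasIndex q (some L) := by
    obtain ⟨e, he, rfl⟩ := hqτ
    exact source_mem_statesOf (acdLabel_subset hτ he)
  exact (h q _ hq).eq_of_length_eq ⟨hτ, hqτ⟩ ⟨hσ, hqσ⟩ hlen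

/-- In a parity ACD, some edge of a loop is in no node below a deepest node containing the loop. -/
theorem IsParityACD.exists_edgeDepth_eq [Finite E] (h : T.IsParityACD) {l : Set E}
    (hl : T.IsLoop l) {L : T.MaxLoop} {τ : List (Set E)}
    (hτ : τ ∈ (T.acdTree (some L)).nodes) (hlτ : l ⊆ T.acdLabel (some L) τ)
    (hmax : ∀ σ ∈ (T.acdTree (some L)).nodes, l ⊆ T.acdLabel (some L) σ →
      σ.length ≤ τ.length) : ∃ e ∈ l, T.edgeDepth e = τ.length := by
  by_contra! hne
  have hex : ∀ e, ∃ σ, e ∈ l → σ ∈ (T.acdTree (some L)).nodes ∧ e ∈ T.acdLabel (some L) σ ∧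
      σ.length = τ.length + 1 := by
    intro e
    by_cases he : e ∈ l
    · have h1 := length_le_edgeDepth hτ (hlτ he)
      have h2 := hne e he
      obtain ⟨σ, hσ, heσ, hlen⟩ := exists_length_eq_edgeDepth (acdLabel_subset hτ (hlτ he))
      -- Truncating a deepest node of `e` to one level below `τ` keeps `e` in the label, as labels
      -- grow towards the root.
      refine ⟨σ.take (τ.length + 1), fun _ => ⟨SeqTree.take_mem hσ _,
        acdLabel_take_superset hσ _ heσ, ?_⟩⟩
      rw [List.length_take]
      omega
    · exact ⟨[], fun h => absurd h he⟩
  choose f hf using hex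
  obtain ⟨e₀, he₀⟩ := hl.nonempty
  obtain ⟨h1, -, h3⟩ := hf e₀ he₀
  have := hmax (f e₀) h1 fun e he => by
    -- The target of an edge is a state of both its own chosen node and that of the next edge;
    -- parity shape allows one node per state and level.
    have heq : f e₀ = f e := by
      refine hl.apply_eq (fun a ha b hb hab => ?_) he₀ he
      obtain ⟨a1, a2, a3⟩ := hf a ha
      obtain ⟨b1, b2, b3⟩ := hf b hb
      exact h.eq_of_length_eq a1 b1 ((acdLabel_isLoop a1).target_mem a2)
        (hab ▸ source_mem_statesOf b2) (a3.trans b3.symm)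
    rw [heq]
    exact (hf e he).2.1
  omega

/-- In a parity ACD, the depth of an edge, shifted on each maximal loop by a constant of the right
parity, is an equivalent parity condition. -/
theorem IsParityACD.isEquivParity [Finite E] (hacc : ∀ v, T.Accessible v) (h : T.IsParityACD)
    {p : E → ℕ} (hp : ∀ L : T.MaxLoop, ∃ c, (Even c ↔ L.1 ∈ T.F) ∧
      ∀ e ∈ L.1, p e = T.edgeDepth e + c) : T.IsEquivParity p := by
  rw [isEquivParity_iff hacc]
  intro l hl m hm
  obtain ⟨L, hlL⟩ := exists_maxLoop_superset hl
  obtain ⟨c, hc, hpc⟩ := hp L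
  obtain ⟨τ, hτ, hlτ, hmax⟩ := exists_deepest_node hlL
  obtain ⟨e, he, hdepth⟩ := h.exists_edgeDepth_eq hl hτ hlτ hmax
  have hleast : IsLeast (p '' l) (τ.length + c) := by
    refine ⟨⟨e, he, by rw [hpc e (hlL he), hdepth]⟩, ?_⟩
    rintro - ⟨a, ha, rfl⟩
    rw [hpc a (hlL ha)]
    gcongr
    exact length_le_edgeDepth hτ (hlτ ha)
  rw [hm.unique hleast, mem_F_iff_of_deepest hl hτ hlτ hmax, acdLabel_mem_F_iff hτ, Nat.even_add,
    hc]

/-! ### Bounds on heights from an equivalent parity condition. -/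

/-- Along a branch the minimal priority increases strictly. -/
theorem IsEquivParity.le_of_mem_acdTree [Finite E] (hacc : ∀ v, T.Accessible v) {p : E → ℕ}
    (hp : T.IsEquivParity p) {L : T.MaxLoop} {τ : List (Set E)}
    (hτ : τ ∈ (T.acdTree (some L)).nodes) {m n : ℕ} (hm : IsLeast (p '' L.1) m)
    (hn : IsLeast (p '' T.acdLabel (some L) τ) n) : m + τ.length ≤ n := by
  induction τ using List.reverseRecOn generalizing n with
  | nil => exact (hm.unique hn).le
  | append_singleton τ s ih =>
    obtain ⟨h1, h2⟩ := append_singleton_mem_acdTree.1 hτ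
    rw [acdLabel_append_singleton] at hn
    obtain ⟨r, hr⟩ := exists_isLeast_image p (acdLabel_isLoop h1).nonempty
    have h3 := ih h1 hr
    have h4 : r ≤ n := hr.2 (Set.image_mono h2.prop.1 hn.1)
    rw [isEquivParity_iff hacc] at hp
    have h5 := hp _ (acdLabel_isLoop h1) _ hr
    have h6 := hp _ h2.prop.2.1 _ hn
    have h7 := h2.prop.2.2
    have h8 : r ≠ n := by
      rintro rfl
      tauto
    rw [List.length_append, List.length_singleton]
    omega

theorem IsEquivParity.exists_apply_ge [Finite E] (hacc : ∀ v, T.Accessible v) {p : E → ℕ}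
    (hp : T.IsEquivParity p) {L : T.MaxLoop} {τ : List (Set E)}
    (hτ : τ ∈ (T.acdTree (some L)).nodes) {m : ℕ} (hm : IsLeast (p '' L.1) m) :
    ∃ e, m + τ.length ≤ p e := by
  obtain ⟨n, hn⟩ := exists_isLeast_image p (acdLabel_isLoop hτ).nonempty
  have h := hp.le_of_mem_acdTree hacc hτ hm hn
  obtain ⟨e, -, rfl⟩ := hn.1
  exact ⟨e, h⟩

/-- Counts distinct priorities, because the weak condition bounds their number and not their range.
Cutting at `n` makes the least priority of the next level a new element. -/
theorem IsEquivParity.length_add_one_le_encard [Finite E] (hacc : ∀ v, T.Accessible v)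
    {p : E → ℕ} (hp : T.IsEquivParity p) {L : T.MaxLoop} {τ : List (Set E)}
    (hτ : τ ∈ (T.acdTree (some L)).nodes) {n : ℕ}
    (hn : IsLeast (p '' T.acdLabel (some L) τ) n) :
    (τ.length : ℕ∞) + 1 ≤ (p '' L.1 ∩ Set.Iic n).encard := by
  induction τ using List.reverseRecOn generalizing n with
  | nil =>
    simp only [List.length_nil, Nat.cast_zero, zero_add, Set.one_le_encard_iff_nonempty]
    exact ⟨n, hn.1, Set.self_mem_Iic⟩
  | append_singleton τ s ih =>
    obtain ⟨h1, h2⟩ := append_singleton_mem_acdTree.1 hτ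
    obtain ⟨r, hr⟩ := exists_isLeast_image p (acdLabel_isLoop h1).nonempty
    have hnL := Set.image_mono (f := p) (acdLabel_subset hτ) hn.1
    rw [acdLabel_append_singleton] at hn
    have h3 := ih h1 hr
    have h4 : r ≤ n := hr.2 (Set.image_mono h2.prop.1 hn.1)
    rw [isEquivParity_iff hacc] at hp
    have h5 := hp _ (acdLabel_isLoop h1) _ hr
    have h6 := hp _ h2.prop.2.1 _ hn
    have h7 := h2.prop.2.2
    have h8 : r ≠ n := by
      rintro rfl
      tauto
    have h9 : n ∉ p '' L.1 ∩ Set.Iic r := by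
      rintro ⟨-, h⟩
      exact h8 (le_antisymm h4 h)
    calc ((τ ++ [s]).length : ℕ∞) + 1 = (τ.length : ℕ∞) + 1 + 1 := by simp
      _ ≤ (p '' L.1 ∩ Set.Iic r).encard + 1 := by gcongr
      _ = (insert n (p '' L.1 ∩ Set.Iic r)).encard := (Set.encard_insert_of_notMem h9).symm
      _ ≤ (p '' L.1 ∩ Set.Iic n).encard := by
        refine Set.encard_le_encard (Set.insert_subset ⟨hnL, Set.self_mem_Iic⟩ ?_)
        exact Set.inter_subset_inter_right _ (Set.Iic_subset_Iic.2 h4)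

theorem natCast_add_one_le {a b : ℕ} : (a : ℕ∞) + 1 ≤ b ↔ a + 1 ≤ b := by
  exact_mod_cast Iff.rfl

/-- Bounds on the height of a tree from bounds on the lengths of its nodes. -/
theorem acdTree_height_le {L : T.MaxLoop} {η : ℕ}
    (h : ∀ τ ∈ (T.acdTree (some L)).nodes, τ.length + 1 ≤ η) :
    (T.acdTree (some L)).height ≤ η :=
  SeqTree.height_le fun τ hτ => natCast_add_one_le.2 (h τ hτ)

theorem acdTree_height_ne {L : T.MaxLoop} {η : ℕ}
    (h : ∀ τ ∈ (T.acdTree (some L)).nodes, τ.length + 2 ≤ η) :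
    (T.acdTree (some L)).height ≠ η := by
  intro heq
  -- The root gives `2 ≤ η`, so that the truncated `η - 1` below is a true predecessor.
  have h0 := h [] (nil_mem_acdTree L)
  have := acdTree_height_le (η := η - 1) fun τ hτ => Nat.le_sub_one_of_lt (h τ hτ)
  rw [heq, Nat.cast_le] at this
  omega

theorem IsEquivParity.isOneParityACD [Finite E] (hacc : ∀ v, T.Accessible v) {p : E → ℕ}
    (hp : T.IsEquivParity p) {η : ℕ} (hη : 1 ≤ η) (h : ∀ e, p e ∈ Set.Icc 1 η) :
    T.IsOneParityACD η := by
  refine ⟨(hp.unionCompatible hacc).isParityACD, ?_, ?_⟩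
  · rintro (_ | L)
    · exact acdTree_none_height_le.trans (by exact_mod_cast hη)
    · refine acdTree_height_le fun τ hτ => ?_
      obtain ⟨m, hm⟩ := exists_isLeast_image p L.2.prop.nonempty
      obtain ⟨a, -, ha⟩ := hm.1
      obtain ⟨e, he⟩ := hp.exists_apply_ge hacc hτ hm
      have h1 := (h e).2
      have h2 := (h a).1
      omega
  · intro L heq hF
    refine acdTree_height_ne (fun τ hτ => ?_) heq
    obtain ⟨m, hm⟩ := exists_isLeast_image p L.2.prop.nonempty
    obtain ⟨e, he⟩ := hp.exists_apply_ge hacc hτ hm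
    -- An accepting root has an even least priority, hence at least 2: priority 1 is lost and the
    -- height cannot be `η`.
    obtain ⟨c, hc⟩ := ((isEquivParity_iff hacc).1 hp _ L.2.prop m hm).2 hF
    obtain ⟨a, -, ha⟩ := hm.1
    have h1 := (h e).2
    have h2 := (h a).1
    omega

theorem IsEquivParity.isZeroParityACD [Finite E] (hacc : ∀ v, T.Accessible v) {p : E → ℕ}
    (hp : T.IsEquivParity p) {η : ℕ} (hη : 1 ≤ η) (h : ∀ e, p e ∈ Set.Icc 0 (η - 1)) :
    T.IsZeroParityACD η := by
  refine ⟨(hp.unionCompatible hacc).isParityACD, ?_, ?_⟩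
  · rintro (_ | L)
    · exact acdTree_none_height_le.trans (by exact_mod_cast hη)
    · refine acdTree_height_le fun τ hτ => ?_
      obtain ⟨m, hm⟩ := exists_isLeast_image p L.2.prop.nonempty
      obtain ⟨e, he⟩ := hp.exists_apply_ge hacc hτ hm
      have h1 := (h e).2
      omega
  · intro L heq
    by_contra hF
    refine acdTree_height_ne (fun τ hτ => ?_) heq
    obtain ⟨m, hm⟩ := exists_isLeast_image p L.2.prop.nonempty
    obtain ⟨e, he⟩ := hp.exists_apply_ge hacc hτ hm
    have hm0 : m ≠ 0 := by
      rintro rfl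
      exact hF (((isEquivParity_iff hacc).1 hp _ L.2.prop 0 hm).1 Even.zero)
    have h1 := (h e).2
    omega

theorem IsEquivParity.isWeakACD [Finite E] (hacc : ∀ v, T.Accessible v) {p : E → ℕ}
    (hp : T.IsEquivParity p) {k : ℕ} (hk : 1 ≤ k) (h : T.IsWeak k p) : T.IsWeakACD k := by
  refine ⟨(hp.unionCompatible hacc).isParityACD, ?_⟩
  rintro (_ | L)
  · exact acdTree_none_height_le.trans (by exact_mod_cast hk)
  · obtain ⟨s, c, hc, hcard⟩ := h
    refine SeqTree.height_le fun τ hτ => ?_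
    obtain ⟨n, hn⟩ := exists_isLeast_image p (acdLabel_isLoop hτ).nonempty
    obtain ⟨e₀, he₀⟩ := L.2.prop.nonempty
    refine (hp.length_add_one_le_encard hacc hτ hn).trans
      ((Set.encard_le_encard ?_).trans (hcard (c (T.source e₀))))
    refine Set.inter_subset_left.trans (Set.image_mono fun e he => ⟨?_, ?_⟩)
    · exact hc.eq_of_isLoop L.2.prop (source_mem_statesOf he) (source_mem_statesOf he₀)
    · exact hc.eq_of_isLoop L.2.prop (L.2.prop.target_mem he) (source_mem_statesOf he₀)

/-! ### Optimal priorities from the ACD. -/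

open Classical in
/-- The depth of an edge, shifted by `a` on the accepting maximal loops, by `b` on the rejecting
ones, and by `c` outside the loops. -/
noncomputable def depthPriority (T : MullerSystem V E) (a b c : ℕ) (e : E) : ℕ :=
  T.edgeDepth e + if ∃ L : T.MaxLoop, e ∈ L.1 ∧ L.1 ∈ T.F then a
    else if ∃ L : T.MaxLoop, e ∈ L.1 then b else c

theorem depthPriority_of_mem {a b c : ℕ} {L : T.MaxLoop} {e : E} (he : e ∈ L.1)
    (hF : L.1 ∈ T.F) : T.depthPriority a b c e = T.edgeDepth e + a := by
  rw [depthPriority, if_pos ⟨L, he, hF⟩]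

theorem depthPriority_of_notMem {a b c : ℕ} {L : T.MaxLoop} {e : E} (he : e ∈ L.1)
    (hF : L.1 ∉ T.F) : T.depthPriority a b c e = T.edgeDepth e + b := by
  rw [depthPriority, if_neg, if_pos ⟨L, he⟩]
  rintro ⟨M, hM, hMF⟩
  exact hF (MaxLoop.eq_of_mem he hM ▸ hMF)

theorem depthPriority_of_forall_notMem {a b c : ℕ} {e : E} (he : ∀ L : T.MaxLoop, e ∉ L.1) :
    T.depthPriority a b c e = c := by
  rw [depthPriority, if_neg, if_neg, edgeDepth_eq_zero he, zero_add]
  · rintro ⟨L, hL⟩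
    exact he L hL
  · rintro ⟨L, hL, -⟩
    exact he L hL

theorem IsParityACD.isEquivParity_depthPriority [Finite E] (hacc : ∀ v, T.Accessible v)
    (h : T.IsParityACD) {a b : ℕ} (ha : Even a) (hb : ¬ Even b) (c : ℕ) :
    T.IsEquivParity (T.depthPriority a b c) := by
  refine h.isEquivParity hacc fun L => ?_
  by_cases hF : L.1 ∈ T.F
  · exact ⟨a, iff_of_true ha hF, fun e he => depthPriority_of_mem he hF⟩
  · exact ⟨b, iff_of_false hb hF, fun e he => depthPriority_of_notMem he hF⟩

theorem edgeDepth_add_one_le [Finite E] {L : T.MaxLoop} {e : E} (he : e ∈ L.1) {η : ℕ}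
    (h : (T.acdTree (some L)).height ≤ η) : T.edgeDepth e + 1 ≤ η :=
  natCast_add_one_le.1 ((edgeDepth_add_one_le_height he).trans h)

theorem edgeDepth_add_two_le [Finite E] {L : T.MaxLoop} {e : E} (he : e ∈ L.1) {η : ℕ}
    (h : (T.acdTree (some L)).height ≤ η) (hne : (T.acdTree (some L)).height ≠ η) :
    T.edgeDepth e + 2 ≤ η := by
  have h1 := (edgeDepth_add_one_le_height he).trans_lt (h.lt_of_ne hne)
  have h2 : T.edgeDepth e + 1 < η := by exact_mod_cast h1
  exact h2

theorem IsOneParityACD.exists_isEquivParity [Finite E] (hacc : ∀ v, T.Accessible v) {η : ℕ}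
    (hη : 1 ≤ η) (h : T.IsOneParityACD η) :
    ∃ p : E → ℕ, T.IsEquivParity p ∧ ∀ e, p e ∈ Set.Icc 1 η := by
  -- Priorities start at 1, so even trees must be shifted by 2; they can afford it, as their height
  -- is not `η`.
  refine ⟨T.depthPriority 2 1 1, h.1.isEquivParity_depthPriority hacc (by decide) (by decide) 1,
    fun e => ?_⟩
  by_cases he : ∃ L : T.MaxLoop, e ∈ L.1
  · obtain ⟨L, he⟩ := he
    by_cases hF : L.1 ∈ T.F
    · rw [depthPriority_of_mem he hF]
      exact ⟨by omega, edgeDepth_add_two_le he (h.2.1 _) fun heq => h.2.2 L heq hF⟩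
    · rw [depthPriority_of_notMem he hF]
      exact ⟨by omega, edgeDepth_add_one_le he (h.2.1 _)⟩
  · rw [depthPriority_of_forall_notMem (not_exists.1 he)]
    exact ⟨le_rfl, hη⟩

theorem IsZeroParityACD.exists_isEquivParity [Finite E] (hacc : ∀ v, T.Accessible v) {η : ℕ}
    (h : T.IsZeroParityACD η) :
    ∃ p : E → ℕ, T.IsEquivParity p ∧ ∀ e, p e ∈ Set.Icc 0 (η - 1) := by
  -- Here the odd trees pay the extra shift, and they are the ones whose height is below `η`.
  refine ⟨T.depthPriority 0 1 0, h.1.isEquivParity_depthPriority hacc (by decide) (by decide) 0,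
    fun e => ⟨Nat.zero_le _, ?_⟩⟩
  by_cases he : ∃ L : T.MaxLoop, e ∈ L.1
  · obtain ⟨L, he⟩ := he
    by_cases hF : L.1 ∈ T.F
    · rw [depthPriority_of_mem he hF]
      have := edgeDepth_add_one_le he (h.2.1 _)
      omega
    · rw [depthPriority_of_notMem he hF]
      have := edgeDepth_add_two_le he (h.2.1 _) fun heq => hF (h.2.2 L heq)
      omega
  · rw [depthPriority_of_forall_notMem (not_exists.1 he)]
    exact Nat.zero_le _

open Classical in
-- Weak conditions.
/-- An ordered partition each of whose components meets only accepting, or only rejecting, maximal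
loops. -/
noncomputable def component (T : MullerSystem V E) (v : V) : ℕ :=
  2 * (T.reach v).ncard + if ∃ L : T.MaxLoop, v ∈ T.statesOf L.1 ∧ L.1 ∉ T.F then 1 else 0

theorem component_lt [Finite V] (v : V) :
    T.component v < 2 * (Set.univ : Set V).ncard + 2 := by
  have : (T.reach v).ncard ≤ (Set.univ : Set V).ncard :=
    Set.ncard_le_ncard (Set.subset_univ _) (Set.toFinite _)
  unfold component
  split_ifs <;> omega

theorem component_of_mem {L : T.MaxLoop} {v : V} (hv : v ∈ T.statesOf L.1) (hF : L.1 ∈ T.F) :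
    T.component v = 2 * (T.reach v).ncard := by
  rw [component, if_neg, add_zero]
  rintro ⟨M, hM, hMF⟩
  exact hMF (MaxLoop.eq_of_mem_statesOf hv hM ▸ hF)

theorem component_of_notMem {L : T.MaxLoop} {v : V} (hv : v ∈ T.statesOf L.1)
    (hF : L.1 ∉ T.F) : T.component v = 2 * (T.reach v).ncard + 1 := by
  rw [component, if_pos ⟨L, hv, hF⟩]

/-- If the reachable set shrinks, doubling its size outweighs the status bit. Otherwise the edge
lies on a loop, whose states share that bit. Hence edges inside a component always lie on loops. -/
theorem component_target_le [Finite V] [Finite E] (e : E) :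
    T.component (T.target e) ≤ T.component (T.source e) ∧
      (T.component (T.target e) = T.component (T.source e) → ∃ L : T.MaxLoop, e ∈ L.1) := by
  rcases lt_or_ge (T.reach (T.target e)).ncard (T.reach (T.source e)).ncard with h | h
  · have : T.component (T.target e) < T.component (T.source e) := by
      unfold component
      split_ifs <;> omega
    exact ⟨this.le, fun h => absurd h this.ne⟩
  · obtain ⟨l, hl, hel⟩ := exists_isLoop_of_ncard_reach_le h
    obtain ⟨L, hlL⟩ := exists_maxLoop_superset hl
    have heL := hlL hel
    refine ⟨?_, fun _ => ⟨L, heL⟩⟩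
    have hle := Set.ncard_le_ncard (reach_target_subset (G := T.toTransitionGraph) e)
      (Set.toFinite _)
    by_cases hF : L.1 ∈ T.F
    · rw [component_of_mem (source_mem_statesOf heL) hF,
        component_of_mem (L.2.prop.target_mem heL) hF]
      omega
    · rw [component_of_notMem (source_mem_statesOf heL) hF,
        component_of_notMem (L.2.prop.target_mem heL) hF]
      omega

theorem IsWeakACD.exists_isEquivParity [Finite V] [Finite E] (hacc : ∀ v, T.Accessible v) {k : ℕ}
    (h : T.IsWeakACD k) : ∃ p : E → ℕ, T.IsEquivParity p ∧ T.IsWeak k p := by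
  refine ⟨T.depthPriority 0 1 0, h.1.isEquivParity_depthPriority hacc (by decide) (by decide) 0,
    _, fun v => ⟨T.component v, component_lt v⟩, fun e => (component_target_le e).1, ?_⟩
  intro i
  -- For an edge inside component `i`, the parity of `i` is the status bit of its maximal loop and
  -- equals the shift, 0 or 1; depths are below `k`.
  refine (Set.encard_le_encard (t := Set.Ico (i.1 % 2) (i.1 % 2 + k)) ?_).trans ?_
  · rintro - ⟨e, ⟨h1, h2⟩, rfl⟩
    have h1' := congrArg Fin.val h1
    have h2' := congrArg Fin.val h2
    simp only at h1' h2'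
    obtain ⟨L, he⟩ := (component_target_le e).2 (h2'.trans h1'.symm)
    have hd := edgeDepth_add_one_le he (h.2 _)
    rw [Set.mem_Ico]
    by_cases hF : L.1 ∈ T.F
    · rw [component_of_mem (source_mem_statesOf he) hF] at h1'
      rw [depthPriority_of_mem he hF]
      omega
    · rw [component_of_notMem (source_mem_statesOf he) hF] at h1'
      rw [depthPriority_of_notMem he hF]
      omega
  · rw [← Finset.coe_Ico, Set.encard_coe_eq_coe_finsetCard, Nat.card_Ico]
    simp

end MullerSystem

/-! ### The equivalences. -/

theorem mainTheorem8 {V E : Type*} [Finite V] [Finite E] (T : MullerSystem V E)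
    (hacc : ∀ v : V, T.Accessible v) :
    List.TFAE
      [ ∃ p : E → ℕ, T.IsEquivParity p,
        ∀ l₁ l₂ : Set E, T.IsLoop l₁ → T.IsLoop l₂ → T.IsLoop (l₁ ∪ l₂) →
          (l₁ ∈ T.F ↔ l₂ ∈ T.F) → (l₁ ∪ l₂ ∈ T.F ↔ l₁ ∈ T.F),
        T.IsParityACD ] ∧
    (∀ η : ℕ, 1 ≤ η →
      ((∃ p : E → ℕ, T.IsEquivParity p ∧ ∀ e, p e ∈ Set.Icc 1 η) ↔ T.IsOneParityACD η)) ∧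
    (∀ η : ℕ, 1 ≤ η →
      ((∃ p : E → ℕ, T.IsEquivParity p ∧ ∀ e, p e ∈ Set.Icc 0 (η - 1)) ↔
        T.IsZeroParityACD η)) ∧
    (∀ k : ℕ, 1 ≤ k →
      ((∃ p : E → ℕ, T.IsEquivParity p ∧ T.IsWeak k p) ↔ T.IsWeakACD k)) := by
  refine ⟨?_, fun η hη => ⟨?_, fun h => h.exists_isEquivParity hacc hη⟩,
    fun η hη => ⟨?_, fun h => h.exists_isEquivParity hacc⟩,
    fun k hk => ⟨?_, fun h => h.exists_isEquivParity hacc⟩⟩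
  · tfae_have 1 → 2 := fun ⟨_, hp⟩ => hp.unionCompatible hacc
    tfae_have 2 → 3 := fun h => MullerSystem.UnionCompatible.isParityACD h
    tfae_have 3 → 1 := fun h =>
      ⟨_, h.isEquivParity_depthPriority hacc (a := 0) (b := 1) (by decide) (by decide) 0⟩
    tfae_finish
  · rintro ⟨p, hp, h⟩
    exact hp.isOneParityACD hacc hη h
  · rintro ⟨p, hp, h⟩
    exact hp.isZeroParityACD hacc hη h
  · rintro ⟨p, hp, h⟩
    exact hp.isWeakACD hacc hk h
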